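/- Let $k$ be a field that is finite or countable, and let $K/k$ be a finitely generated field extension of transcendence degree at least $2$. Let $\mathrm{ZR}(K/k)$ be the set of all valuations $\nu$ on $K$ (with values in arbitrary totally ordered abelian groups, written additively, the trivial valuation included) such that $\nu(c)=0$ for all $c\in k\setminus\{0\}$, where two valuations are identified if they have the same valuation ring. Endow $\mathrm{ZR}(K/k)$ with the Patch topology, that is, the topology generated by the sets $\{\nu \mid \nu(x)\ge 0\}$ and $\{\nu\mid \nu(x)>0\}$, where $x$ runs over $K$. Then $\mathrm{ZR}(K/k)$ is a Cantor set, that is, it is homeomorphic to $\{0,1\}^{\mathbb{N}}$ with the product topology (equivalently, it is a non-empty, compact, metrizable, totally disconnected space without isolated points). -/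

import Mathlib

/-- The Zariski-Riemann space `ZR(K)` of a field `K`: the set of equivalence classes of valuations
on `K`, where two valuations are equivalent when they have the same valuation ring. A class is
recorded by its valuation ring; the trivial valuation corresponds to the ring `K` itself. For
`A : ZR K`, the map `A.valuation` is a representative of the class. Mathlib writes valuations
multiplicatively with the order reversed: the additive `ν(x) ≥ 0`, `ν(x) > 0`, `ν(x) = 0` read
`v x ≤ 1`, `v x < 1`, `v x = 1`. -/
def ZR (K : Type*) [Field K] : Type _ := ValuationSubring K

namespace ZR

variable {K : Type*} [Field K]

/-- The valuation ring `V_ν` of a point `ν`. -/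
def ring (ν : ZR K) : ValuationSubring K := ν

/-- The canonical valuation representing a point `ν`. -/
noncomputable def val (ν : ZR K) : Valuation K ν.ring.ValueGroup := ν.ring.valuation

/-- The class of a valuation. -/
def mk {Γ : Type*} [LinearOrderedCommGroupWithZero Γ] (v : Valuation K Γ) : ZR K :=
  v.valuationSubring

/-- Every point is the class of a valuation. -/
theorem mk_val (ν : ZR K) : mk ν.val = ν :=
  ValuationSubring.valuationSubring_valuation ν.ring

/-- Two valuations have the same class if and only if they are equivalent. -/
theorem mk_eq_mk_iff {Γ Γ' : Type*} [LinearOrderedCommGroupWithZero Γ]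
    [LinearOrderedCommGroupWithZero Γ'] (v : Valuation K Γ) (w : Valuation K Γ') :
    mk v = mk w ↔ v.IsEquiv w :=
  (Valuation.isEquiv_iff_valuationSubring v w).symm

/-- The canonical representative of the class of `v` is equivalent to `v`. -/
theorem isEquiv_val_mk {Γ : Type*} [LinearOrderedCommGroupWithZero Γ] (v : Valuation K Γ) :
    v.IsEquiv (mk v).val :=
  Valuation.isEquiv_valuation_valuationSubring v

/-- `O(x)`, the set of `ν` with `ν(x) ≥ 0`. -/
def O (x : K) : Set (ZR K) := {ν | ν.val x ≤ 1}

/-- `U(x)`, the set of `ν` with `ν(x) > 0`. -/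
def U (x : K) : Set (ZR K) := {ν | ν.val x < 1}

/-- The patch topology on `ZR(K)`: the topology generated by all the sets `O(x)` and `U(x)`. -/
instance patchTopology : TopologicalSpace (ZR K) :=
  TopologicalSpace.generateFrom (Set.range O ∪ Set.range U)

/-- `ZR(K/k)`, the set of `ν` with `ν(c) = 0` for all `c ≠ 0` in `k`. As a type it carries the
topology induced by the patch topology of `ZR(K)`. -/
def relative (k K : Type*) [Field k] [Field K] [Algebra k K] : Set (ZR K) :=
  {ν | ∀ c : k, c ≠ 0 → ν.val (algebraMap k K c) = 1}

end ZR

/-- A Cantor set: a topological space homeomorphic to the Cantor space `{0,1}^ℕ` with the product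
topology (`Bool` being discrete). -/
def IsCantorSet (X : Type*) [TopologicalSpace X] : Prop := Nonempty (X ≃ₜ (ℕ → Bool))

/-! By Brouwer's characterisation (`isCantorSet_of_separating`), compactness, a countable separating
family of clopen sets and the absence of isolated points suffice. The sets `O x` are clopen and
determine the valuation ring, and `K` is countable; ultrafilter limits give compactness.

The substance is that no point `V` is isolated (`exists_valuationSubring_ne`). A neighbourhood of
`V` is controlled by finitely many elements of `V`. Put them in a finitely generated `k`-algebra `A
⊆ V` with `K` algebraic over `A`, and let `M` be a maximal ideal of `A` containing the centre of
`V`. Every valuation ring that contains `A` and has `M` in its maximal ideal lies in the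
neighbourhood. As the transcendence degree is at least 2, `exists_incomparable_primes_le` gives
primes `p, q ≤ M` with `a ∈ p \ q` and `b ∈ q \ p`. By `exists_valuationSubring_div_mem_nonunits`
one such ring has `a / b` in its maximal ideal and another has `b / a`. They differ, so one of them
is not `V`. -/

/-! ### A characterisation of the Cantor set -/

/-- Cut the space repeatedly into two nonempty clopen pieces, the `n`-th cut being at least as fine
as `C n`. The itinerary of a point through this binary tree is injective by separation and
surjective by compactness. -/
theorem isCantorSet_of_separating {X : Type*} [TopologicalSpace X] [CompactSpace X] [Nonempty X]
    (hiso : ∀ x : X, ¬ IsOpen {x}) (C : ℕ → Set X) (hC : ∀ n, IsClopen (C n))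
    (hsep : ∀ x y, (∀ n, x ∈ C n ↔ y ∈ C n) → x = y) : IsCantorSet X := by
  classical
  have split : ∀ (n : ℕ) (A : Set X), ∃ D : Set X, IsClopen D ∧
      (IsClopen A → A.Nonempty → (A ∩ D).Nonempty ∧ (A ∩ Dᶜ).Nonempty) ∧
      (∀ x ∈ A, ∀ y ∈ A, (x ∈ D ↔ y ∈ D) → (x ∈ C n ↔ y ∈ C n)) := by
    intro n A
    by_cases h : (A ∩ C n).Nonempty ∧ (A ∩ (C n)ᶜ).Nonempty
    · exact ⟨C n, hC n, fun _ _ => h, fun _ _ _ _ => id⟩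
    have hn : ∀ x ∈ A, ∀ y ∈ A, (x ∈ C n ↔ y ∈ C n) := by
      have key : ∀ x ∈ A, ∀ y ∈ A, x ∈ C n → y ∈ C n := fun x hx y hy hxn =>
        by_contra fun hyn => h ⟨⟨x, hx, hxn⟩, ⟨y, hy, hyn⟩⟩
      exact fun x hx y hy => ⟨key x hx y hy, key y hy x hx⟩
    -- `C n` is constant on `A`, so any cut respects it; an open `A` has two points, and some `C m`
    -- separates them.
    by_cases hA : IsClopen A ∧ A.Nonempty
    · obtain ⟨hA, x, hx⟩ := hA
      obtain ⟨y, hy, hyx⟩ : ∃ y ∈ A, y ≠ x := by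
        by_contra! hall
        exact hiso x ((Set.eq_singleton_iff_unique_mem.2 ⟨hx, hall⟩) ▸ hA.isOpen)
      obtain ⟨m, hm⟩ : ∃ m, ¬ (y ∈ C m ↔ x ∈ C m) := by
        by_contra! hall
        exact hyx (hsep y x hall)
      refine ⟨C m, hC m, fun _ _ => ?_, fun x hx y hy _ => hn x hx y hy⟩
      by_cases hxm : x ∈ C m
      · exact ⟨⟨x, hx, hxm⟩, ⟨y, hy, fun hym => hm (iff_of_true hym hxm)⟩⟩
      · exact ⟨⟨y, hy, by_contra fun hym => hm (iff_of_false hym hxm)⟩, ⟨x, hx, hxm⟩⟩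
    · exact ⟨C n, hC n, fun h1 h2 => (hA ⟨h1, h2⟩).elim, fun x hx y hy _ => hn x hx y hy⟩
  choose D hD hDsplit hDsep using split
  -- `A s n` is the tree node reached by the first `n` bits of `s`, `B x n` the node of level `n`
  -- containing `x`, and `φ x` the itinerary of `x`.
  let next : ℕ → Set X → Bool → Set X := fun n A b => if b then A ∩ D n A else A ∩ (D n A)ᶜ
  let A : (ℕ → Bool) → ℕ → Set X := fun s n => Nat.rec Set.univ (fun n A => next n A (s n)) n
  let B : X → ℕ → Set X := fun x n =>
    Nat.rec Set.univ (fun n A => next n A (decide (x ∈ D n A))) n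
  let φ : X → ℕ → Bool := fun x n => decide (x ∈ D n (B x n))
  have hAsucc : ∀ s n, A s (n + 1) = next n (A s n) (s n) := fun _ _ => rfl
  have hBsucc : ∀ x n, B x (n + 1) = next n (B x n) (φ x n) := fun _ _ => rfl
  have next_clopen : ∀ n E b, IsClopen E → IsClopen (next n E b) := by
    intro n E b hE
    cases b
    · exact hE.inter (hD n E).compl
    · exact hE.inter (hD n E)
  have next_sub : ∀ n E b, next n E b ⊆ E := by
    intro n E b
    cases b <;> exact Set.inter_subset_left
  have mem_next : ∀ n E b x, x ∈ next n E b ↔ x ∈ E ∧ decide (x ∈ D n E) = b := by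
    intro n E b x
    cases b <;> simp [next]
  have A_prop : ∀ s n, IsClopen (A s n) ∧ (A s n).Nonempty := by
    intro s n
    induction n with
    | zero => exact ⟨isClopen_univ, Set.univ_nonempty⟩
    | succ n ih =>
      refine ⟨next_clopen n _ _ ih.1, ?_⟩
      have := hDsplit n _ ih.1 ih.2
      rw [hAsucc]
      cases s n
      · exact this.2
      · exact this.1
  have B_clopen : ∀ x n, IsClopen (B x n) := by
    intro x n
    induction n with
    | zero => exact isClopen_univ
    | succ n ih => exact next_clopen n _ _ ih
  have B_mem : ∀ x n, x ∈ B x n := by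
    intro x n
    induction n with
    | zero => exact Set.mem_univ _
    | succ n ih => rw [hBsucc, mem_next]; exact ⟨ih, rfl⟩
  have B_eq : ∀ x y n, y ∈ B x n → B y n = B x n := by
    intro x y n
    induction n with
    | zero => exact fun _ => rfl
    | succ n ih =>
      intro hy
      rw [hBsucc, mem_next] at hy
      have h1 := ih hy.1
      rw [hBsucc, hBsucc, h1]
      congr 1
      simp only [φ, h1]
      exact hy.2
  have φ_cont : Continuous φ := by
    refine continuous_pi fun n => IsLocallyConstant.continuous ?_
    rw [IsLocallyConstant.iff_eventually_eq]
    intro x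
    filter_upwards [(B_clopen x (n + 1)).isOpen.mem_nhds (B_mem x (n + 1))] with y hy
    rw [hBsucc, mem_next] at hy
    simp only [φ, B_eq x y n hy.1]
    exact hy.2
  have φ_inj : Function.Injective φ := by
    intro x y hxy
    have hB : ∀ n, B x n = B y n := by
      intro n
      induction n with
      | zero => rfl
      | succ n ih => rw [hBsucc, hBsucc, ih, hxy]
    refine hsep x y fun n => hDsep n (B x n) x (B_mem x n) y (hB n ▸ B_mem y n) ?_
    have := congrFun hxy n
    simp only [φ, ← hB n, decide_eq_decide] at this
    exact this
  have φ_surj : Function.Surjective φ := by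
    intro s
    obtain ⟨x, hx⟩ := IsCompact.nonempty_iInter_of_sequence_nonempty_isCompact_isClosed (A s)
      (fun n => next_sub n _ _) (fun n => (A_prop s n).2) (A_prop s 0).1.isClosed.isCompact
      (fun n => (A_prop s n).1.isClosed)
    rw [Set.mem_iInter] at hx
    have hφ : ∀ n, B x n = A s n → φ x n = s n := by
      intro n h
      have := hx (n + 1)
      rw [hAsucc, mem_next] at this
      simp only [φ, h]
      exact this.2
    have hBA : ∀ n, B x n = A s n := by
      intro n
      induction n with
      | zero => rfl
      | succ n ih => rw [hBsucc, hAsucc, ih, hφ n ih]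
    exact ⟨x, funext fun n => hφ n (hBA n)⟩
  exact ⟨Continuous.homeoOfEquivCompactToT2
    (f := Equiv.ofBijective φ ⟨φ_inj, φ_surj⟩) φ_cont⟩

/-! ### Compactness and neighbourhoods in the patch topology -/

namespace ZR

variable {K : Type*} [Field K]

theorem mem_O {x : K} {ν : ZR K} : ν ∈ O x ↔ x ∈ ν.ring :=
  ValuationSubring.valuation_le_one_iff _ _

theorem mem_U {x : K} {ν : ZR K} : ν ∈ U x ↔ x ∈ ν.ring.nonunits :=
  Iff.rfl

theorem compl_U {x : K} (hx : x ≠ 0) : (U x)ᶜ = O x⁻¹ := by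
  ext ν
  have : 0 < ν.val x := zero_lt_iff.2 ((Valuation.ne_zero_iff _).2 hx)
  simp [U, O, inv_le_one₀ this]

theorem isOpen_O (x : K) : IsOpen (O x) :=
  .basic _ (.inl ⟨x, rfl⟩)

theorem isOpen_U (x : K) : IsOpen (U x) :=
  .basic _ (.inr ⟨x, rfl⟩)

theorem U_zero : U (0 : K) = Set.univ := by
  ext; simp [U]

theorem O_zero : O (0 : K) = Set.univ := by
  ext; simp [O]

theorem isClopen_O (x : K) : IsClopen (O x) := by
  refine ⟨?_, isOpen_O x⟩
  obtain rfl | hx := eq_or_ne x 0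
  · rw [O_zero]
    exact isClosed_univ
  · rw [← inv_inv x, ← compl_U (inv_ne_zero hx)]
    exact (isOpen_U _).isClosed_compl

theorem ext_ring {ν μ : ZR K} (h : ∀ x, x ∈ ν.ring ↔ x ∈ μ.ring) : ν = μ :=
  SetLike.ext (A := ValuationSubring K) h

/-- The limit of an ultrafilter on the Zariski-Riemann space: the ring of those elements that
almost all the valuation rings contain. -/
def ultrafilterLimit (F : Ultrafilter (ZR K)) : ZR K :=
  ({ carrier := {x | ∀ᶠ ν : ZR K in F, x ∈ ν.ring}
     mul_mem' := fun {a b} (ha : ∀ᶠ ν : ZR K in F, a ∈ ν.ring)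
       (hb : ∀ᶠ ν : ZR K in F, b ∈ ν.ring) => (ha.and hb).mono fun _ h => mul_mem h.1 h.2
     one_mem' := .of_forall fun ν => one_mem ν.ring
     add_mem' := fun {a b} (ha : ∀ᶠ ν : ZR K in F, a ∈ ν.ring)
       (hb : ∀ᶠ ν : ZR K in F, b ∈ ν.ring) => (ha.and hb).mono fun _ h => add_mem h.1 h.2
     zero_mem' := .of_forall fun ν => zero_mem ν.ring
     neg_mem' := fun {a} (ha : ∀ᶠ ν : ZR K in F, a ∈ ν.ring) => ha.mono fun _ h => neg_mem h
     mem_or_inv_mem' := fun x => Ultrafilter.eventually_or.1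
       (.of_forall fun ν : ZR K => ν.ring.mem_or_inv_mem x) } : ValuationSubring K)

theorem mem_ring_ultrafilterLimit {F : Ultrafilter (ZR K)} {x : K} :
    x ∈ (ultrafilterLimit F).ring ↔ ∀ᶠ ν : ZR K in F, x ∈ ν.ring :=
  Iff.rfl

instance : CompactSpace (ZR K) := by
  refine ⟨isCompact_iff_ultrafilter_le_nhds.2 fun F _ => ?_⟩
  refine ⟨ultrafilterLimit F, Set.mem_univ _, ?_⟩
  have hO : ∀ x : K, ultrafilterLimit F ∈ O x ↔ O x ∈ F := by
    intro x
    rw [mem_O, mem_ring_ultrafilterLimit]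
    simp only [← mem_O]
    rfl
  rw [TopologicalSpace.nhds_generateFrom]
  refine le_iInf₂ fun s hs => Filter.le_principal_iff.2 ?_
  obtain ⟨hs, ⟨x, rfl⟩ | ⟨x, rfl⟩⟩ := hs
  · exact (hO x).1 hs
  · obtain rfl | hx := eq_or_ne x 0
    · rw [U_zero]
      exact Filter.univ_mem
    · refine Ultrafilter.compl_notMem_iff.1 ?_
      rw [compl_U hx, ← hO, ← compl_U hx]
      exact fun h => h hs

theorem mem_relative {k : Type*} [Field k] [Algebra k K] {ν : ZR K} :
    ν ∈ relative k K ↔ ∀ c : k, algebraMap k K c ∈ ν.ring := by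
  refine ⟨fun h c => ?_, fun h c hc => ?_⟩
  · obtain rfl | hc := eq_or_ne c 0
    · rw [map_zero]
      exact zero_mem _
    · exact mem_O.1 (h c hc).le
  · refine le_antisymm (mem_O.2 (h c)) ?_
    have h1 : ν.val (algebraMap k K c)⁻¹ ≤ 1 := by
      rw [← map_inv₀]
      exact mem_O.2 (h c⁻¹)
    rw [map_inv₀] at h1
    exact (inv_le_one₀ (zero_lt_iff.2 (by simpa using hc))).1 h1

theorem isClosed_relative (k : Type*) [Field k] [Algebra k K] : IsClosed (relative k K) := by
  have : relative k K = ⋂ c : k, O (algebraMap k K c) := by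
    ext ν
    simp [mem_relative, mem_O]
  rw [this]
  exact isClosed_iInter fun c => (isClopen_O _).1

/-- Every neighbourhood of a point of the patch topology is given by finitely many elements of the
valuation ring, together with those of them that lie in the maximal ideal. -/
theorem exists_finset_of_isOpen {W : Set (ZR K)} (hW : IsOpen W) {ν : ZR K} (hν : ν ∈ W) :
    ∃ S : Set K, S.Finite ∧ (∀ x ∈ S, x ∈ ν.ring) ∧
      ∀ μ : ZR K, (∀ x ∈ S, x ∈ μ.ring) →
        (∀ x ∈ S, x ∈ ν.ring.nonunits → x ∈ μ.ring.nonunits) → μ ∈ W := by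
  induction hW with
  | basic s hs =>
    obtain ⟨x, rfl⟩ | ⟨x, rfl⟩ := hs
    · exact ⟨{x}, Set.finite_singleton x, by simpa using mem_O.1 hν,
        fun μ h _ => mem_O.2 (h x rfl)⟩
    · have hx := mem_U.1 hν
      exact ⟨{x}, Set.finite_singleton x, by simpa using ValuationSubring.nonunits_subset hx,
        fun μ _ h => mem_U.2 (h x rfl hx)⟩
  | univ => exact ⟨∅, Set.finite_empty, by simp, by simp⟩
  | inter s t _ _ hs ht =>
    obtain ⟨S, hSf, hSν, hS⟩ := hs hν.1
    obtain ⟨T, hTf, hTν, hT⟩ := ht hν.2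
    refine ⟨S ∪ T, hSf.union hTf, fun x hx => hx.elim (hSν x) (hTν x), fun μ h1 h2 => ⟨?_, ?_⟩⟩
    · exact hS μ (fun x hx => h1 x (.inl hx)) (fun x hx => h2 x (.inl hx))
    · exact hT μ (fun x hx => h1 x (.inr hx)) (fun x hx => h2 x (.inr hx))
  | sUnion 𝒮 _ ih =>
    obtain ⟨s, hs, hνs⟩ := hν
    obtain ⟨S, hSf, hSν, hS⟩ := ih s hs hνs
    exact ⟨S, hSf, hSν, fun μ h1 h2 => ⟨s, hs, hS μ h1 h2⟩⟩

end ZR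

/-! ### Valuation rings dominating a given ideal -/

/-- Let `𝔭 ⊆ M` be ideals of a subring `A` of a field, `𝔭` prime. If `a ∈ 𝔭` and `b ∉ 𝔭`, then some
valuation ring contains `A`, and its maximal ideal contains both `M` and `a / b`. -/
theorem exists_valuationSubring_div_mem_nonunits {K : Type*} [Field K] {A : Subring K}
    {M p : Ideal A} (hM : M ≠ ⊤) [p.IsPrime] (hpM : p ≤ M) {a b : A} (ha0 : a ≠ 0)
    (ha : a ∈ p) (hb : b ∉ p) :
    ∃ V : ValuationSubring K, A ≤ V.toSubring ∧ (∀ x ∈ M, (x : K) ∈ V.nonunits) ∧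
      (a / b : K) ∈ V.nonunits := by
  have hb0 : b ≠ 0 := fun h => hb (h ▸ zero_mem p)
  have ha0' : (a : K) ≠ 0 := by simpa using ha0
  have hb0' : (b : K) ≠ 0 := by simpa using hb0
  let : Invertible (a / b : K) := invertibleOfNonzero (div_ne_zero ha0' hb0')
  let B := Algebra.adjoin A {(a / b : K)}
  let x : B := ⟨(a / b : K), Algebra.subset_adjoin rfl⟩
  have hJ : M.map (algebraMap A B) ⊔ Ideal.span {x} ≠ ⊤ := by
    intro htop
    obtain ⟨f, hf, hroot⟩ :=
      Algebra.exists_aeval_invOf_eq_zero_of_idealMap_adjoin_sup_span_eq_top _ M hM htop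
    -- `b / a` is a root of `f`, whose leading coefficient is 1 modulo `M`.
    have hlc : f.leadingCoeff ∉ p := fun h => hM <| (Ideal.eq_top_iff_one M).2 <| by
      simpa using sub_mem (hpM h) hf
    have hroot' : Polynomial.aeval (algebraMap A K b / algebraMap A K a) f = 0 := by
      rw [← hroot, invOf_eq_inv, inv_div]
      rfl
    have h0 := Polynomial.scaleRoots_aeval_eq_zero_of_aeval_div_eq_zero
      (FaithfulSMul.algebraMap_injective A K) hroot' (mem_nonZeroDivisors_of_ne_zero ha0)
    rw [Polynomial.aeval_algebraMap_apply,
      map_eq_zero_iff _ (FaithfulSMul.algebraMap_injective A K), Polynomial.coe_aeval_eq_eval] at h0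
    -- Denominators are cleared; modulo `p`, where `a` vanishes, only the leading coefficient times
    -- a power of `b` survives.
    have h1 := congrArg (Ideal.Quotient.mk p) h0
    rw [← Polynomial.eval_map_apply, Polynomial.map_scaleRoots _ _ _
      (by rwa [Ne, Ideal.Quotient.eq_zero_iff_mem]), Ideal.Quotient.eq_zero_iff_mem.2 ha,
      Polynomial.scaleRoots_zero, map_zero, Polynomial.eval_smul, Polynomial.eval_pow,
      Polynomial.eval_X, smul_eq_mul] at h1
    rcases mul_eq_zero.1 h1 with h2 | h2
    · rw [Polynomial.leadingCoeff_map_of_leadingCoeff_ne_zero _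
        (by rwa [Ne, Ideal.Quotient.eq_zero_iff_mem])] at h2
      exact hlc (Ideal.Quotient.eq_zero_iff_mem.1 h2)
    · exact hb (Ideal.Quotient.eq_zero_iff_mem.1 (eq_zero_of_pow_eq_zero h2))
  obtain ⟨V, hBV, hJV⟩ := Ideal.image_subset_nonunits_valuationSubring (A := B.toSubring) _ hJ
  refine ⟨V, fun r hr => hBV (B.algebraMap_mem ⟨r, hr⟩), fun y hy => hJV ⟨algebraMap A B y, ?_, rfl⟩,
    hJV ⟨x, ?_, rfl⟩⟩
  · exact Ideal.mem_sup_left (Ideal.mem_map_of_mem _ hy)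
  · exact Ideal.mem_sup_right (Ideal.subset_span rfl)

/-! ### Incomparable primes below a maximal ideal -/

theorem Ideal.IsPrime.exists_prime_dvd_mem {R : Type*} [CommRing R] [IsDomain R]
    [UniqueFactorizationMonoid R] {I : Ideal R} (hI : I.IsPrime) {h : R} (h0 : h ≠ 0)
    (hmem : h ∈ I) : ∃ f, Prime f ∧ f ∣ h ∧ f ∈ I := by
  obtain ⟨s, hs, hprod⟩ := UniqueFactorizationMonoid.exists_prime_factors h h0
  have : s.prod ∈ I := (Ideal.mem_iff_of_associated hprod).2 hmem
  obtain ⟨f, hfs, hf⟩ := (hI.multiset_prod_mem_iff_exists_mem s).1 this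
  exact ⟨f, hs f hfs, (Multiset.dvd_prod hfs).trans hprod.dvd, hf⟩

theorem MvPolynomial.aeval_X_ne_zero {σ k : Type*} [Field k] (i : σ) {h : Polynomial k}
    (h0 : h ≠ 0) : Polynomial.aeval (X i : MvPolynomial σ k) h ≠ 0 := fun he =>
  h0 (transcendental_iff.1 ((algebraicIndependent_X σ k).transcendental i) h he)

open MvPolynomial in
theorem MvPolynomial.degreeOf_eq_zero_of_dvd_aeval_X {σ k : Type*} [Field k] {i j : σ}
    (hij : j ≠ i) {h : Polynomial k} (h0 : h ≠ 0) {f : MvPolynomial σ k}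
    (hf : f ∣ Polynomial.aeval (X i) h) : degreeOf j f = 0 := by
  have hne := aeval_X_ne_zero i h0
  have hsupp : Polynomial.aeval (X i : MvPolynomial σ k) h ∈ supported k {i} := by
    rw [supported, Set.image_singleton]
    exact Polynomial.aeval_mem_adjoin_singleton k _
  have hdeg : degreeOf j (Polynomial.aeval (X i : MvPolynomial σ k) h) = 0 := by
    by_contra hj
    exact hij (mem_supported.1 hsupp (mem_vars_iff_degreeOf_ne_zero.2 hj))
  obtain ⟨g, hg⟩ := hf
  rw [hg] at hne
  rw [hg, degreeOf_mul_eq (left_ne_zero_of_mul hne) (right_ne_zero_of_mul hne)] at hdeg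
  omega

open MvPolynomial in
-- Degrees in each variable add in products, so a common divisor involves no variable at all. This
-- makes the two primes chosen in `exists_incomparable_primes_le` non-associated.
theorem MvPolynomial.isUnit_of_dvd_aeval_X {σ k : Type*} [Field k] {i j : σ} (hij : i ≠ j)
    {h₁ h₂ : Polynomial k} (hh₁ : h₁ ≠ 0) (hh₂ : h₂ ≠ 0) {f : MvPolynomial σ k}
    (hf₁ : f ∣ Polynomial.aeval (X i) h₁) (hf₂ : f ∣ Polynomial.aeval (X j) h₂) : IsUnit f := by
  have hdeg : ∀ l, degreeOf l f = 0 := by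
    intro l
    by_cases hl : l = i
    · exact degreeOf_eq_zero_of_dvd_aeval_X (hl ▸ hij) hh₂ hf₂
    · exact degreeOf_eq_zero_of_dvd_aeval_X hl hh₁ hf₁
  have htot : f.vars = ∅ := Finset.eq_empty_of_forall_notMem fun l hl =>
    mem_vars_iff_degreeOf_ne_zero.1 hl (hdeg l)
  rw [vars_eq_empty_iff_eq_C] at htot
  have hf0 : f ≠ 0 := by
    rintro rfl
    exact aeval_X_ne_zero i hh₁ (zero_dvd_iff.1 hf₁)
  rw [htot] at hf0 ⊢
  exact (IsUnit.mk0 _ fun h => hf0 (by rw [h, C_0])).map C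

/-- A maximal ideal of a finitely generated domain of transcendence degree at least two contains
two incomparable primes. -/
theorem exists_incomparable_primes_le {k A : Type*} [Field k] [CommRing A] [IsDomain A]
    [Algebra k A] [Algebra.FiniteType k A] (htr : 2 ≤ Algebra.trdeg k A) (M : Ideal A)
    [M.IsMaximal] :
    ∃ a b : A, a ≠ 0 ∧ b ≠ 0 ∧ (∃ p : Ideal A, p.IsPrime ∧ p ≤ M ∧ a ∈ p ∧ b ∉ p) ∧
      ∃ q : Ideal A, q.IsPrime ∧ q ≤ M ∧ b ∈ q ∧ a ∉ q := by
  obtain ⟨d, g, hginj, hgint⟩ := exists_integral_inj_algHom_of_fg k A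
  let P := MvPolynomial (Fin d) k
  algebraize [g.toRingHom]
  have : FaithfulSMul P A := (faithfulSMul_iff_algebraMap_injective P A).2 hginj
  have : IsScalarTower k P A := .of_algebraMap_eq fun c => (g.commutes c).symm
  have hd : 2 ≤ d := by
    have h1 := lift_trdeg_add_eq k P A
    rw [trdeg_eq_zero (R := P) (A := A), MvPolynomial.trdeg_of_isDomain] at h1
    have h2 := Cardinal.lift_le.{u_1}.2 htr
    rw [← h1] at h2
    simpa using h2
  let := Ideal.Quotient.field M
  -- Nullstellensatz: each variable is algebraic over `k` modulo `M`.
  have : Module.Finite k (A ⧸ M) := finite_of_finite_type_of_isJacobsonRing k (A ⧸ M)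
  have key : ∀ i : Fin d, ∃ (h : Polynomial k) (f : P), h ≠ 0 ∧ Prime f ∧
      f ∣ Polynomial.aeval (MvPolynomial.X i) h ∧ f ∈ M.under P := by
    intro i
    obtain ⟨h, hmon, hh⟩ := Algebra.IsIntegral.isIntegral (R := k)
      (Ideal.Quotient.mk M (algebraMap P A (MvPolynomial.X i)))
    have hmem : Polynomial.aeval (MvPolynomial.X i) h ∈ M.under P := by
      rw [Ideal.mem_comap, ← Ideal.Quotient.eq_zero_iff_mem, ← hh]
      have := Polynomial.aeval_algHom_apply
        ((Ideal.Quotient.mkₐ k M).comp (IsScalarTower.toAlgHom k P A)) (MvPolynomial.X i) h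
      exact this.symm
    obtain ⟨f, hf, hdvd, hfM⟩ := Ideal.IsPrime.exists_prime_dvd_mem (inferInstance)
      (MvPolynomial.aeval_X_ne_zero i hmon.ne_zero) hmem
    exact ⟨h, f, hmon.ne_zero, hf, hdvd, hfM⟩
  have down : ∀ f f' : P, Prime f → f ∈ M.under P → ¬ f ∣ f' →
      ∃ p : Ideal A, p.IsPrime ∧ p ≤ M ∧ algebraMap P A f ∈ p ∧ algebraMap P A f' ∉ p := by
    intro f f' hf hfM hff'
    have : (Ideal.span {f}).IsPrime := (Ideal.span_singleton_prime hf.ne_zero).2 hf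
    -- Going-down, available since `P` is integrally closed and the domain `A` is integral over it.
    obtain ⟨p, hpM, hp, hpf⟩ := Ideal.exists_ideal_le_liesOver_of_le (q := M.under P) M
      ((Ideal.span_singleton_le_iff_mem _).2 hfM)
    refine ⟨p, hp, hpM, ?_, fun h => hff' ?_⟩
    · rw [← Ideal.mem_of_liesOver p (Ideal.span {f})]
      exact Ideal.mem_span_singleton_self f
    · rw [← Ideal.mem_of_liesOver p (Ideal.span {f})] at h
      exact Ideal.mem_span_singleton.1 h
  obtain ⟨h₁, f₁, hh₁, hf₁, hd₁, hM₁⟩ := key ⟨0, by omega⟩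
  obtain ⟨h₂, f₂, hh₂, hf₂, hd₂, hM₂⟩ := key ⟨1, by omega⟩
  have hne : (⟨0, by omega⟩ : Fin d) ≠ ⟨1, by omega⟩ := by simp
  refine ⟨algebraMap P A f₁, algebraMap P A f₂, ?_, ?_,
    down f₁ f₂ hf₁ hM₁ fun h => hf₁.not_isUnit ?_, down f₂ f₁ hf₂ hM₂ fun h => hf₂.not_isUnit ?_⟩
  · exact (map_ne_zero_iff _ hginj).2 hf₁.ne_zero
  · exact (map_ne_zero_iff _ hginj).2 hf₂.ne_zero
  · exact MvPolynomial.isUnit_of_dvd_aeval_X hne hh₁ hh₂ hd₁ (h.trans hd₂)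
  · exact MvPolynomial.isUnit_of_dvd_aeval_X hne hh₁ hh₂ (h.trans hd₁) hd₂

/-! ### No isolated points -/

/-- A valuation ring of a function field contains a finitely generated subalgebra whose fraction
field is the whole field, and which contains prescribed elements. -/
theorem exists_subalgebra_fg_le_valuationSubring {k K : Type*} [Field k] [Field K] [Algebra k K]
    (hfg : (⊤ : IntermediateField k K).FG) (V : ValuationSubring K)
    (hV : ∀ c : k, algebraMap k K c ∈ V) {S : Set K} (hS : S.Finite) (hSV : ∀ x ∈ S, x ∈ V) :
    ∃ A : Subalgebra k K, A.FG ∧ (∀ x ∈ A, x ∈ V) ∧ (∀ x ∈ S, x ∈ A) ∧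
      Algebra.IsAlgebraic A K := by
  classical
  obtain ⟨T, hT⟩ := hfg
  -- Inverting the generators outside `V` keeps the generated field and moves them into `V`.
  let T' : Set K := (fun x => if x ∈ V then x else x⁻¹) '' T
  have hTV : ∀ x ∈ T', x ∈ V := by
    rintro _ ⟨x, -, rfl⟩
    dsimp only
    split_ifs with h
    · exact h
    · exact (V.mem_or_inv_mem x).resolve_left h
  have htop : IntermediateField.adjoin k (S ∪ T') = ⊤ := by
    rw [eq_top_iff, ← hT, IntermediateField.adjoin_le_iff]
    intro x hx
    have h : (if x ∈ V then x else x⁻¹) ∈ IntermediateField.adjoin k (S ∪ T') :=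
      IntermediateField.subset_adjoin _ _ (.inr ⟨x, hx, rfl⟩)
    split_ifs at h with hxV
    · exact h
    · simpa using inv_mem h
  let V' : Subalgebra k K := { V.toSubring with algebraMap_mem' := hV }
  refine ⟨Algebra.adjoin k (S ∪ T'), ?_, fun x hx => ?_,
    fun x hx => Algebra.subset_adjoin (.inl hx), ⟨fun x => ?_⟩⟩
  · exact Subalgebra.fg_def.2 ⟨_, hS.union (T.finite_toSet.image _), rfl⟩
  · have : Algebra.adjoin k (S ∪ T') ≤ V' :=
      Algebra.adjoin_le fun y hy => hy.elim (hSV y) (hTV y)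
    exact this hx
  · have hx : x ∈ IntermediateField.adjoin k (S ∪ T') := htop ▸ IntermediateField.mem_top
    obtain ⟨r, hr, s, hs, rfl⟩ := IntermediateField.mem_adjoin_iff_div.1 hx
    rw [div_eq_mul_inv]
    exact (isAlgebraic_algebraMap (⟨r, hr⟩ : Algebra.adjoin k (S ∪ T'))).mul
      (isAlgebraic_algebraMap (⟨s, hs⟩ : Algebra.adjoin k (S ∪ T'))).inv

/-- The algebraic form of the absence of isolated points in the patch topology. -/
theorem exists_valuationSubring_ne {k K : Type*} [Field k] [Field K] [Algebra k K]
    (hfg : (⊤ : IntermediateField k K).FG) (htr : 2 ≤ Algebra.trdeg k K) (V : ValuationSubring K)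
    (hV : ∀ c : k, algebraMap k K c ∈ V) {S : Set K} (hS : S.Finite) (hSV : ∀ x ∈ S, x ∈ V) :
    ∃ W : ValuationSubring K, W ≠ V ∧ (∀ c : k, algebraMap k K c ∈ W) ∧ (∀ x ∈ S, x ∈ W) ∧
      ∀ x ∈ S, x ∈ V.nonunits → x ∈ W.nonunits := by
  obtain ⟨A, hA, hAV, hSA, hAK⟩ := exists_subalgebra_fg_le_valuationSubring hfg V hV hS hSV
  have : Algebra.FiniteType k A := A.fg_iff_finiteType.1 hA
  have htrA : 2 ≤ Algebra.trdeg k A := by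
    rwa [← trdeg_add_eq k A (A := K), trdeg_eq_zero (R := A), add_zero] at htr
  let i : A →+* V := Subring.inclusion (S := A.toSubring) (T := V.toSubring) hAV
  obtain ⟨M, hM, hmM⟩ := ((IsLocalRing.maximalIdeal V).comap i).exists_le_maximal
    (Ideal.comap_ne_top _ (IsLocalRing.maximalIdeal.isMaximal V).ne_top)
  obtain ⟨a, b, ha0, hb0, ⟨p, hp, hpM, hap, hbp⟩, q, hq, hqM, hbq, haq⟩ :=
    exists_incomparable_primes_le htrA M
  have main : ∀ W : ValuationSubring K, A.toSubring ≤ W.toSubring →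
      (∀ x ∈ M, (x : K) ∈ W.nonunits) → (∀ c : k, algebraMap k K c ∈ W) ∧ (∀ x ∈ S, x ∈ W) ∧
      ∀ x ∈ S, x ∈ V.nonunits → x ∈ W.nonunits := by
    intro W hAW hMW
    refine ⟨fun c => hAW (A.algebraMap_mem c), fun x hx => hAW (hSA x hx), fun x hx hxV => ?_⟩
    refine hMW ⟨x, hSA x hx⟩ (hmM ?_)
    exact V.mem_nonunits_iff_exists_mem_maximalIdeal.1 hxV |>.2
  obtain ⟨W₁, hA₁, hM₁, h₁⟩ := exists_valuationSubring_div_mem_nonunits (A := A.toSubring)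
    (M := M) (p := p) hM.ne_top hpM ha0 hap hbp
  obtain ⟨W₂, hA₂, hM₂, h₂⟩ := exists_valuationSubring_div_mem_nonunits (A := A.toSubring)
    (M := M) (p := q) hM.ne_top hqM hb0 hbq haq
  -- `a / b` and `b / a` cannot both be nonunits of `V`, as their product is 1.
  by_cases hW : W₁ = V
  · refine ⟨W₂, ?_, main W₂ hA₂ hM₂⟩
    rintro rfl
    rw [hW] at h₁
    rw [ValuationSubring.mem_nonunits_iff] at h₁ h₂
    have := mul_lt_one_of_lt_of_le h₁ h₂.le
    rw [← map_mul, div_mul_div_cancel₀ (by simpa using hb0), div_self (by simpa using ha0),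
      map_one] at this
    exact this.false
  · exact ⟨W₁, hW, main W₁ hA₁ hM₁⟩
theorem ZR.not_isOpen_singleton_relative {k K : Type*} [Field k] [Field K] [Algebra k K]
    (hfg : (⊤ : IntermediateField k K).FG) (htr : 2 ≤ Algebra.trdeg k K) (ν : relative k K) :
    ¬ IsOpen {ν} := by
  intro h
  obtain ⟨W, hW, hWν⟩ := isOpen_induced_iff.1 h
  have hν : ν.1 ∈ W := by
    have : ν ∈ Subtype.val ⁻¹' W := hWν ▸ Set.mem_singleton ν
    exact this
  obtain ⟨S, hSf, hSν, hS⟩ := exists_finset_of_isOpen hW hν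
  obtain ⟨V, hVne, hVk, hVS, hVS'⟩ :=
    exists_valuationSubring_ne hfg htr ν.1.ring (mem_relative.1 ν.2) hSf hSν
  let μ : relative k K := ⟨V, mem_relative.2 hVk⟩
  have hμ : μ ∈ Subtype.val ⁻¹' W := hS V hVS hVS'
  rw [hWν] at hμ
  exact hVne (congrArg Subtype.val hμ)

theorem countable_of_fg_top {k K : Type*} [Field k] [Field K] [Algebra k K] [Countable k]
    (hfg : (⊤ : IntermediateField k K).FG) : Countable K := by
  obtain ⟨T, hT⟩ := hfg
  have h := IntermediateField.lift_cardinalMk_adjoin_le k (T : Set K)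
  have hk := Cardinal.lift_le_aleph0.2 (Cardinal.mk_le_aleph0 (α := k))
  have hTc := Cardinal.lift_le_aleph0.2 (Cardinal.mk_le_aleph0 (α := (T : Set K)))
  have hc := Cardinal.lift_le_aleph0.1 (h.trans (sup_le (sup_le hk hTc) le_rfl))
  rw [hT, Cardinal.mk_le_aleph0_iff] at hc
  exact (IntermediateField.topEquiv (F := k) (E := K)).toEquiv.countable_iff.1 hc

theorem mainTheorem11 {k K : Type*} [Field k] [Field K] [Algebra k K] [Countable k]
    (hfg : (⊤ : IntermediateField k K).FG) (htr : 2 ≤ Algebra.trdeg k K) :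
    IsCantorSet (ZR.relative k K) := by
  have := countable_of_fg_top hfg
  have : CompactSpace (ZR.relative k K) :=
    isCompact_iff_compactSpace.1 (ZR.isClosed_relative k).isCompact
  have : Nonempty (ZR.relative k K) :=
    ⟨⟨(⊤ : ValuationSubring K), ZR.mem_relative.2 fun _ => ValuationSubring.mem_top _⟩⟩
  obtain ⟨e, he⟩ := exists_surjective_nat K
  refine isCantorSet_of_separating (ZR.not_isOpen_singleton_relative hfg htr)
    (fun n => Subtype.val ⁻¹' ZR.O (e n))
    (fun n => (ZR.isClopen_O (e n)).preimage continuous_subtype_val) fun ν μ h => ?_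
  refine Subtype.ext (ZR.ext_ring fun x => ?_)
  obtain ⟨n, rfl⟩ := he x
  exact ZR.mem_O.symm.trans ((h n).trans ZR.mem_O)
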